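/- Let $d \ge 3$, and let $\widehat H_0$ be the bounded operator on $\ell^2(\mathbf Z^d)$ (complex-valued sequences) given by $$ (\widehat H_0 \widehat f)(n) = \frac d2\,\widehat f(n) - \frac14 \sum_{j=1}^d \big\{\widehat f(n+e_j) + \widehat f(n-e_j)\big\}, $$ where $e_1,\dots,e_d$ is the standard basis of $\mathbf Z^d$. Let $\widehat V : \mathbf Z^d \to \mathbf C$ be a complex-valued potential such that, for some real $s > 2$, $\widehat V(n) = O(|n|^{-s})$ as $|n| \to \infty$, where $|n|$ is the Euclidean norm; write $\widehat V$ also for the bounded operator of multiplication by $\widehat V(n)$ on $\ell^2(\mathbf Z^d)$. For $\gamma \in \mathbf C$ put $\widehat H_\gamma = \widehat H_0 + \gamma \widehat V$. Then there exists a constant $\delta > 0$ such that for every $\gamma \in \mathbf C$ with $|\gamma| < \delta$ the operator $\widehat H_\gamma$ has no eigenvalues: for no $E \in \mathbf C$ is there a nonzero $\widehat f \in \ell^2(\mathbf Z^d)$ with $\widehat H_\gamma \widehat f = E \widehat f$. -/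

import Mathlib

open Filter Asymptotics
open scoped ENNReal

/-- The Hilbert space `ℓ²(ℤᵈ)` of square-summable complex-valued functions on `ℤᵈ`. -/
abbrev LatticeL2 (d : ℕ) : Type := lp (fun _ : Fin d → ℤ => ℂ) 2

/-- The Euclidean length `|n| = (n₁² + ⋯ + n_d²)^{1/2}` of a lattice point. -/
noncomputable def latticeNorm {d : ℕ} (n : Fin d → ℤ) : ℝ :=
  Real.sqrt (∑ j, (n j : ℝ) ^ 2)

theorem memlp_two_shift {d : ℕ} (v : Fin d → ℤ) (f : LatticeL2 d) :
    Memℓp (fun n : Fin d → ℤ => f (n + v)) 2 := by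
  have h := (memℓp_gen_iff (p := 2) (by norm_num)).1 (lp.memℓp f)
  exact (memℓp_gen_iff (p := 2) (by norm_num)).2
    (h.comp_injective (add_left_injective v))

/-- The shift operator `(S_v f)(n) = f(n + v)` on `ℓ²(ℤᵈ)`. -/
noncomputable def latticeShift {d : ℕ} (v : Fin d → ℤ) : LatticeL2 d →L[ℂ] LatticeL2 d :=
  LinearMap.mkContinuous
    { toFun := fun f => ⟨fun n => f (n + v), memlp_two_shift v f⟩
      map_add' := fun _ _ => rfl
      map_smul' := fun _ _ => rfl }
    1 (by
      intro f
      rw [one_mul, lp.norm_eq_tsum_rpow (by norm_num), lp.norm_eq_tsum_rpow (by norm_num)]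
      exact le_of_eq (congrArg (fun x : ℝ => x ^ (1 / (2 : ℝ≥0∞).toReal))
        ((Equiv.addRight v).tsum_eq fun n => ‖f n‖ ^ (2 : ℝ≥0∞).toReal)))

theorem latticeShift_apply {d : ℕ} (v : Fin d → ℤ) (f : LatticeL2 d) (n : Fin d → ℤ) :
    latticeShift v f n = f (n + v) := rfl

/-- The free Hamiltonian `Ĥ₀ = d/2 - (1/4) ∑ⱼ (Sⱼ + Sⱼ*)` on `ℓ²(ℤᵈ)`, with `Sⱼ` the shift
by the `j`-th standard basis vector. -/
noncomputable def freeHamiltonian (d : ℕ) : LatticeL2 d →L[ℂ] LatticeL2 d :=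
  ((d : ℂ) / 2) • ContinuousLinearMap.id ℂ (LatticeL2 d) -
    (1 / 4 : ℂ) • ∑ j : Fin d,
      (latticeShift (Pi.single j (1 : ℤ)) + latticeShift (-Pi.single j (1 : ℤ)))

theorem freeHamiltonian_apply (d : ℕ) (f : LatticeL2 d) (n : Fin d → ℤ) :
    freeHamiltonian d f n = (d : ℂ) / 2 * f n -
      1 / 4 * ∑ j : Fin d, (f (n + Pi.single j 1) + f (n - Pi.single j 1)) := by
  simp only [freeHamiltonian, sub_apply, smul_apply, ContinuousLinearMap.id_apply, sum_apply,
    add_apply, lp.coeFn_sub, lp.coeFn_smul, lp.coeFn_sum, lp.coeFn_add, Pi.sub_apply,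
    Pi.smul_apply, Pi.add_apply, Finset.sum_apply, latticeShift_apply, smul_eq_mul]
  simp only [sub_eq_add_neg]

theorem norm_le_of_memlp_top {d : ℕ} {V : (Fin d → ℤ) → ℂ} (hV : Memℓp V ∞) :
    ∃ C : ℝ, 0 ≤ C ∧ ∀ n, ‖V n‖ ≤ C := by
  obtain ⟨C, hC⟩ := memℓp_infty_iff.1 hV
  exact ⟨C, (norm_nonneg (V 0)).trans (hC ⟨0, rfl⟩), fun n => hC ⟨n, rfl⟩⟩

theorem memlp_two_mul {d : ℕ} {V : (Fin d → ℤ) → ℂ} (hV : Memℓp V ∞) (f : LatticeL2 d) :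
    Memℓp (fun n => V n * f n) 2 := by
  obtain ⟨C, hC0, hC⟩ := norm_le_of_memlp_top hV
  refine ((lp.memℓp f).const_mul (C : ℂ)).mono' ?_
  intro n
  simp only [norm_mul, Complex.norm_real, Real.norm_eq_abs, abs_of_nonneg hC0]
  exact mul_le_mul_of_nonneg_right (hC n) (norm_nonneg _)

/-- The operator of multiplication by a bounded function `V` on `ℓ²(ℤᵈ)`,
`(V f)(n) = V(n) f(n)`. -/
noncomputable def potentialOperator {d : ℕ} (V : (Fin d → ℤ) → ℂ) (hV : Memℓp V ∞) :
    LatticeL2 d →L[ℂ] LatticeL2 d :=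
  LinearMap.mkContinuousOfExistsBound
    { toFun := fun f => ⟨fun n => V n * f n, memlp_two_mul hV f⟩
      map_add' := fun f g => by ext n; exact mul_add _ _ _
      map_smul' := fun c f => by ext n; exact mul_left_comm _ _ _ }
    (by
      obtain ⟨C, hC0, hC⟩ := norm_le_of_memlp_top hV
      refine ⟨C, fun f => ?_⟩
      have h : ‖(⟨fun n => V n * f n, memlp_two_mul hV f⟩ : LatticeL2 d)‖ ≤ ‖(C : ℂ) • f‖ := by
        refine lp.norm_mono (by norm_num) fun n => ?_
        simp only [lp.coeFn_smul, Pi.smul_apply, smul_eq_mul, norm_mul, Complex.norm_real,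
          Real.norm_eq_abs, abs_of_nonneg hC0]
        exact mul_le_mul_of_nonneg_right (hC n) (norm_nonneg _)
      rwa [norm_smul, Complex.norm_real, Real.norm_eq_abs, abs_of_nonneg hC0] at h)

theorem potentialOperator_apply {d : ℕ} (V : (Fin d → ℤ) → ℂ) (hV : Memℓp V ∞)
    (f : LatticeL2 d) (n : Fin d → ℤ) : potentialOperator V hV f n = V n * f n := rfl

theorem finite_latticeNorm_le {d : ℕ} (R : ℝ) : {n : Fin d → ℤ | latticeNorm n ≤ R}.Finite := by
  refine (Set.Finite.pi' fun _ : Fin d => Set.finite_Icc (-⌈R⌉) ⌈R⌉).subset ?_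
  intro n hn j
  have h1 : |(n j : ℝ)| ≤ R := by
    refine le_trans ?_ hn
    rw [latticeNorm, ← Real.sqrt_sq_eq_abs]
    exact Real.sqrt_le_sqrt
      (Finset.single_le_sum (f := fun i => (n i : ℝ) ^ 2) (fun i _ => sq_nonneg _)
        (Finset.mem_univ j))
  have h2 : |(n j : ℝ)| ≤ (⌈R⌉ : ℝ) := h1.trans (Int.le_ceil R)
  rw [abs_le] at h2
  exact ⟨by exact_mod_cast h2.1, by exact_mod_cast h2.2⟩

/-- A function on `ℤᵈ` which is `O(|n|⁻ˢ)` as `|n| → ∞`, with `s ≥ 0`, is bounded. -/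
theorem memlp_top_of_decay {d : ℕ} {V : (Fin d → ℤ) → ℂ} {s : ℝ} (hs : 0 ≤ s)
    (hV : V =O[comap latticeNorm atTop] fun n => latticeNorm n ^ (-s)) : Memℓp V ∞ := by
  obtain ⟨c, hc⟩ := hV.bound
  obtain ⟨t, ht, hsub⟩ := mem_comap.1 hc
  obtain ⟨R, hR⟩ := mem_atTop_sets.1 ht
  have hfin := ((finite_latticeNorm_le (d := d) (max R 1)).image fun n => ‖V n‖).bddAbove
  obtain ⟨M, hM⟩ := hfin
  refine memℓp_infty_iff.2 ⟨max M |c|, ?_⟩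
  rintro _ ⟨n, rfl⟩
  by_cases h : latticeNorm n ≤ max R 1
  · exact (hM ⟨n, h, rfl⟩).trans (le_max_left _ _)
  · rw [not_le, max_lt_iff] at h
    have h1 : ‖V n‖ ≤ c * ‖latticeNorm n ^ (-s)‖ := hsub (hR _ h.1.le)
    have h0 : (0 : ℝ) ≤ latticeNorm n ^ (-s) := Real.rpow_nonneg (Real.sqrt_nonneg _) _
    have h2 : ‖latticeNorm n ^ (-s)‖ ≤ 1 := by
      rw [Real.norm_of_nonneg h0]
      exact Real.rpow_le_one_of_one_le_of_nonpos h.2.le (by linarith)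
    refine (h1.trans ?_).trans (le_max_right _ _)
    calc c * ‖latticeNorm n ^ (-s)‖ ≤ |c| * ‖latticeNorm n ^ (-s)‖ :=
          mul_le_mul_of_nonneg_right (le_abs_self c) (norm_nonneg _)
      _ ≤ |c| * 1 := mul_le_mul_of_nonneg_left h2 (abs_nonneg c)
      _ = |c| := mul_one _

/-! The mechanism is dispersive decay of `exp(-itĤ₀)`, which needs no self-adjointness of the
perturbed operator. Let `f` be an eigenvector and set `g = Ĥ₀f - Ef = -γVf`. Since `Ĥ₀` is real,
complex conjugation allows `Im E ≥ 0`. Let `P_k` cut off to the dyadic shell `|n|_∞ ~ 2^k`. The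
function `exp(itE)⟨P_j f, exp(-itĤ₀)f⟩` equals `‖P_j f‖²` at `t = 0`, tends to `0` as `t → ∞`, and
has derivative bounded by `|⟨P_j f, exp(-itĤ₀)g⟩|` for `t ≥ 0`.

The kernel of the evolution is a product of `d` Bessel integrals, each `O(t^(-1/2))` well inside the
light cone. With the shell cardinalities this bounds the matrix element between shells `j` and `k`
by a constant times `(1 + t/2^(j+k))^(-3/2)`, which is integrable because `d ≥ 3`, with integral of
order `2^(j+k)` (`norm_inner_freeEvolution_le`). Hence `‖P_j f‖ ≤ C 2^j Z` with `Z = ∑ 2^k ‖P_k g‖`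
(`norm_shellPart_le_tsum`).

The decay of `V` gives `‖P_k g‖ ≤ ε 2^(-sk) ‖P_k f‖` with `ε` proportional to `|γ|`. Substitution
yields `Z ≤ εC Z ∑ (4·2^(-s))^k`. The series converges exactly because `s > 2`, so small `γ` forces
`Z = 0` and then `f = 0` (`eq_zero_of_shell_decay`). -/

/-! ### Decay of Bessel integrals inside the light cone. -/

/-- Where `|cos x| < 1/2`, `|sin x|` is at least `5/6`, hence `sin x` is at distance at least `1/3`
from `σ`. So near a zero of `sin x - σ` the substitution `u = sin x` is nondegenerate. -/
theorem one_le_two_abs_cos_add {σ : ℝ} (hσ : |σ| ≤ 1 / 2) (x : ℝ) :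
    1 ≤ 2 * |Real.cos x| + 9 * (Real.sin x - σ) ^ 2 := by
  rcases le_total (1 / 2) |Real.cos x| with h | h
  · nlinarith [sq_nonneg (Real.sin x - σ)]
  · have h1 : Real.cos x ^ 2 ≤ 1 / 4 := by
      rw [← sq_abs]; nlinarith [abs_nonneg (Real.cos x)]
    have h2 : 3 / 4 ≤ |Real.sin x| ^ 2 := by
      rw [sq_abs]; nlinarith [Real.sin_sq_add_cos_sq x]
    have h3 : 5 / 6 ≤ |Real.sin x| := by nlinarith [abs_nonneg (Real.sin x)]
    have h4 : 1 / 3 ≤ |Real.sin x - σ| := by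
      have := abs_sub_abs_le_abs_sub (Real.sin x) σ
      linarith
    have h5 : 1 / 9 ≤ (Real.sin x - σ) ^ 2 := by
      rw [← sq_abs]; nlinarith
    nlinarith [abs_nonneg (Real.cos x)]

theorem hasDerivAt_arctan_sin {τ : ℝ} (hτ : 0 < τ) (σ x : ℝ) :
    HasDerivAt (fun x => Real.arctan (√τ * (Real.sin x - σ)) / √τ)
      (Real.cos x / (1 + τ * (Real.sin x - σ) ^ 2)) x := by
  have h0 : √τ ≠ 0 := (Real.sqrt_pos.2 hτ).ne'
  have h := ((((Real.hasDerivAt_sin x).sub_const σ).const_mul √τ).arctan).div_const √τ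
  refine h.congr_deriv ?_
  rw [mul_pow, Real.sq_sqrt hτ.le]
  field_simp

theorem continuous_cos_div {τ : ℝ} (hτ : 0 < τ) (σ : ℝ) :
    Continuous fun x => Real.cos x / (1 + τ * (Real.sin x - σ) ^ 2) :=
  Real.continuous_cos.div (by fun_prop) fun x => by positivity

theorem integral_cos_div_eq {τ : ℝ} (hτ : 0 < τ) (σ a b : ℝ) :
    ∫ x in a..b, Real.cos x / (1 + τ * (Real.sin x - σ) ^ 2) =
      Real.arctan (√τ * (Real.sin b - σ)) / √τ - Real.arctan (√τ * (Real.sin a - σ)) / √τ :=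
  intervalIntegral.integral_eq_sub_of_hasDerivAt (fun x _ => hasDerivAt_arctan_sin hτ σ x)
    ((continuous_cos_div hτ σ).intervalIntegrable _ _)

theorem abs_integral_cos_div_le {τ : ℝ} (hτ : 0 < τ) (σ a b : ℝ) :
    |∫ x in a..b, Real.cos x / (1 + τ * (Real.sin x - σ) ^ 2)| ≤ Real.pi / √τ := by
  rw [integral_cos_div_eq hτ, ← sub_div, abs_div, abs_of_nonneg (Real.sqrt_nonneg τ)]
  gcongr
  rw [abs_le]
  constructor <;>
    linarith [Real.arctan_lt_pi_div_two (√τ * (Real.sin b - σ)),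
      Real.neg_pi_div_two_lt_arctan (√τ * (Real.sin b - σ)),
      Real.arctan_lt_pi_div_two (√τ * (Real.sin a - σ)),
      Real.neg_pi_div_two_lt_arctan (√τ * (Real.sin a - σ))]

/-- The period starts at `-π/2` so that `cos` has one sign on each half; each half is then an
arctangent increment. -/
theorem integral_abs_cos_div_le {τ : ℝ} (hτ : 0 < τ) (σ : ℝ) :
    ∫ x in (-(Real.pi / 2))..(3 * Real.pi / 2),
      |Real.cos x| / (1 + τ * (Real.sin x - σ) ^ 2) ≤ 2 * (Real.pi / √τ) := by
  have hpi := Real.pi_pos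
  have hc : Continuous fun x => |Real.cos x| / (1 + τ * (Real.sin x - σ) ^ 2) :=
    Real.continuous_cos.abs.div (by fun_prop) fun x => by positivity
  rw [← intervalIntegral.integral_add_adjacent_intervals
    (hc.intervalIntegrable (-(Real.pi / 2)) (Real.pi / 2)) (hc.intervalIntegrable _ _)]
  have h1 : ∫ x in (-(Real.pi / 2))..(Real.pi / 2),
      |Real.cos x| / (1 + τ * (Real.sin x - σ) ^ 2) =
      ∫ x in (-(Real.pi / 2))..(Real.pi / 2),
        Real.cos x / (1 + τ * (Real.sin x - σ) ^ 2) := by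
    refine intervalIntegral.integral_congr fun x hx => ?_
    rw [Set.uIcc_of_le (by linarith)] at hx
    simp only [abs_of_nonneg (Real.cos_nonneg_of_mem_Icc hx)]
  have h2 : ∫ x in (Real.pi / 2)..(3 * Real.pi / 2),
      |Real.cos x| / (1 + τ * (Real.sin x - σ) ^ 2) =
      -∫ x in (Real.pi / 2)..(3 * Real.pi / 2),
        Real.cos x / (1 + τ * (Real.sin x - σ) ^ 2) := by
    rw [← intervalIntegral.integral_neg]
    refine intervalIntegral.integral_congr fun x hx => ?_
    rw [Set.uIcc_of_le (by linarith)] at hx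
    simp only [abs_of_nonpos (Real.cos_nonpos_of_pi_div_two_le_of_le hx.1
      (by linarith [hx.2])), neg_div]
  rw [h1, h2]
  linarith [le_abs_self (∫ x in (-(Real.pi / 2))..(Real.pi / 2),
      Real.cos x / (1 + τ * (Real.sin x - σ) ^ 2)),
    neg_abs_le (∫ x in (Real.pi / 2)..(3 * Real.pi / 2),
      Real.cos x / (1 + τ * (Real.sin x - σ) ^ 2)),
    abs_integral_cos_div_le hτ σ (-(Real.pi / 2)) (Real.pi / 2),
    abs_integral_cos_div_le hτ σ (Real.pi / 2) (3 * Real.pi / 2)]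

theorem integral_inv_one_add_le {τ σ : ℝ} (hτ : 0 < τ) (hσ : |σ| ≤ 1 / 2) :
    ∫ x in (-(Real.pi / 2))..(3 * Real.pi / 2), 1 / (1 + τ * (Real.sin x - σ) ^ 2) ≤
      4 * (Real.pi / √τ) + 18 * Real.pi / τ := by
  have hpi := Real.pi_pos
  have hc : Continuous fun x => |Real.cos x| / (1 + τ * (Real.sin x - σ) ^ 2) :=
    Real.continuous_cos.abs.div (by fun_prop) fun x => by positivity
  have hc1 : Continuous fun x => 1 / (1 + τ * (Real.sin x - σ) ^ 2) :=
    continuous_const.div (by fun_prop) fun x => by positivity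
  calc ∫ x in (-(Real.pi / 2))..(3 * Real.pi / 2), 1 / (1 + τ * (Real.sin x - σ) ^ 2)
      ≤ ∫ x in (-(Real.pi / 2))..(3 * Real.pi / 2),
          (2 * (|Real.cos x| / (1 + τ * (Real.sin x - σ) ^ 2)) + 9 / τ) := by
        refine intervalIntegral.integral_mono_on (by linarith) (hc1.intervalIntegrable _ _)
          (((hc.const_mul 2).add continuous_const).intervalIntegrable _ _) fun x _ => ?_
        have hp : 0 < 1 + τ * (Real.sin x - σ) ^ 2 := by positivity
        have h := one_le_two_abs_cos_add hσ x
        -- The term `9(sin x - σ)²` divided by the denominator is at most `9/τ`.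
        rw [← mul_div_assoc, div_add_div _ _ hp.ne' hτ.ne', div_le_div_iff₀ hp (by positivity)]
        nlinarith [mul_le_mul_of_nonneg_left h (mul_pos hτ hp).le, hp]
    _ = 2 * (∫ x in (-(Real.pi / 2))..(3 * Real.pi / 2),
          |Real.cos x| / (1 + τ * (Real.sin x - σ) ^ 2)) + 18 * Real.pi / τ := by
        rw [intervalIntegral.integral_add ((hc.const_mul 2).intervalIntegrable _ _)
          (continuous_const.intervalIntegrable _ _), intervalIntegral.integral_const_mul,
          intervalIntegral.integral_const, smul_eq_mul]
        ring
    _ ≤ _ := by linarith [integral_abs_cos_div_le hτ σ]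

/-- The phase integral `∫ exp(i(kx + τ cos x)) dx` over a period, a Bessel function of order `k`. -/
noncomputable def besselIntegral (k : ℤ) (τ : ℝ) : ℂ :=
  ∫ x in (-(Real.pi / 2))..(3 * Real.pi / 2),
    Complex.exp (((k * x + τ * Real.cos x : ℝ) : ℂ) * Complex.I)

theorem hasDerivAt_amplitude {τ : ℝ} (hτ : 0 < τ) (σ x : ℝ) :
    HasDerivAt (fun x => (Real.sin x - σ) / (1 + τ * (Real.sin x - σ) ^ 2))
      (Real.cos x * (1 - τ * (Real.sin x - σ) ^ 2) / (1 + τ * (Real.sin x - σ) ^ 2) ^ 2) x := by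
  have h1 := (Real.hasDerivAt_sin x).sub_const σ
  have h := h1.div (((h1.pow 2).const_mul τ).const_add 1)
    (show (1 + τ * (Real.sin x - σ) ^ 2) ≠ 0 by positivity)
  refine h.congr_deriv ?_
  congr 1
  simp only [Nat.cast_ofNat, Nat.add_one_sub_one, pow_one, Pi.pow_apply]
  ring

/-- A van der Corput argument without splitting the interval. Writing `k = τσ`, the phase derivative
is `-τ(sin x - σ)`. Integrating the derivative of `Q e` trades `e` for terms of size at most `w =
1/(1 + τ(sin x - σ)²)`, a bump of width `τ^(-1/2)` at the stationary points. -/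
theorem norm_besselIntegral_le {k : ℤ} {τ : ℝ} (hτ : 0 < τ) (hk : |(k : ℝ)| ≤ τ / 2) :
    ‖besselIntegral k τ‖ ≤ 2 * (4 * (Real.pi / √τ) + 18 * Real.pi / τ) := by
  have hpi := Real.pi_pos
  set σ : ℝ := k / τ with hσd
  have hkσ : (k : ℝ) = τ * σ := by rw [hσd]; field_simp
  have hσ : |σ| ≤ 1 / 2 := by
    rw [hσd, abs_div, abs_of_pos hτ, div_le_iff₀ hτ]; linarith
  set e : ℝ → ℂ := fun x => Complex.exp (((k * x + τ * Real.cos x : ℝ) : ℂ) * Complex.I) with he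
  set w : ℝ → ℝ := fun x => 1 / (1 + τ * (Real.sin x - σ) ^ 2) with hw
  set Q : ℝ → ℝ := fun x => (Real.sin x - σ) / (1 + τ * (Real.sin x - σ) ^ 2) with hQ
  set Q' : ℝ → ℝ := fun x =>
    Real.cos x * (1 - τ * (Real.sin x - σ) ^ 2) / (1 + τ * (Real.sin x - σ) ^ 2) ^ 2 with hQ'
  have hden : ∀ x, 1 + τ * (Real.sin x - σ) ^ 2 ≠ 0 := fun x => by positivity
  have hec : Continuous e := by fun_prop
  have hwc : Continuous w := continuous_const.div (by fun_prop) hden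
  have hQ'c : Continuous Q' := Continuous.div (by fun_prop) (by fun_prop) fun x => by positivity
  have hen : ∀ x, ‖e x‖ = 1 := fun x => Complex.norm_exp_ofReal_mul_I _
  have hed : ∀ x, HasDerivAt e (e x * (((k - τ * Real.sin x : ℝ) : ℂ) * Complex.I)) x := by
    intro x
    have h1 : HasDerivAt (fun x : ℝ => k * x + τ * Real.cos x) (k - τ * Real.sin x) x := by
      have := ((hasDerivAt_id x).const_mul (k : ℝ)).add ((Real.hasDerivAt_cos x).const_mul τ)
      refine (this.congr_deriv ?_)
      ring
    exact (h1.ofReal_comp.mul_const Complex.I).cexp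
  -- The identity `w = 1 + Q (k - τ sin x)` turns the term `Q e'` into `-i(1 - w)e`.
  have hF : ∀ x, HasDerivAt (fun x => (Q x : ℂ) * e x)
      ((Q' x : ℂ) * e x - Complex.I * e x + Complex.I * (w x * e x)) x := by
    intro x
    have h := (hasDerivAt_amplitude hτ σ x).ofReal_comp.mul (hed x)
    refine h.congr_deriv ?_
    have hwx : (w x : ℂ) = 1 + (Q x : ℂ) * ((k - τ * Real.sin x : ℝ) : ℂ) := by
      rw [← Complex.ofReal_mul, ← Complex.ofReal_one, ← Complex.ofReal_add]
      congr 1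
      simp only [hw, hQ, hkσ]
      have := hden x
      field_simp
      ring
    rw [hwx]
    ring
  have hint := intervalIntegral.integral_eq_sub_of_hasDerivAt
    (a := -(Real.pi / 2)) (b := 3 * Real.pi / 2) (fun x _ => hF x)
    (Continuous.intervalIntegrable (by fun_prop) _ _)
  have hs : Real.sin (3 * Real.pi / 2) = Real.sin (-(Real.pi / 2)) := by
    rw [show 3 * Real.pi / 2 = -(Real.pi / 2) + 2 * Real.pi by ring, Real.sin_add_two_pi]
  -- Boundary terms cancel by periodicity; this is where `k` being an integer matters.
  have hbd : (Q (3 * Real.pi / 2) : ℂ) * e (3 * Real.pi / 2) =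
      (Q (-(Real.pi / 2)) : ℂ) * e (-(Real.pi / 2)) := by
    have h1 : e (3 * Real.pi / 2) = e (-(Real.pi / 2)) := by
      simp only [he]
      rw [Complex.exp_eq_exp_iff_exists_int]
      refine ⟨k, ?_⟩
      rw [show 3 * Real.pi / 2 = -(Real.pi / 2) + 2 * Real.pi by ring, Real.cos_add_two_pi]
      push_cast
      ring
    rw [h1]
    simp only [hQ, hs]
  rw [hbd, sub_self] at hint
  have hkey : besselIntegral k τ =
      ∫ x in (-(Real.pi / 2))..(3 * Real.pi / 2), ((w x : ℂ) * e x - Complex.I * (Q' x * e x)) := by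
    have : ∀ x, ((w x : ℂ) * e x - Complex.I * (Q' x * e x)) = e x - Complex.I *
        ((Q' x : ℂ) * e x - Complex.I * e x + Complex.I * (w x * e x)) := by
      intro x
      linear_combination (w x * e x - e x) * Complex.I_sq
    simp only [this]
    rw [intervalIntegral.integral_sub (hec.intervalIntegrable _ _)
      (Continuous.intervalIntegrable (by fun_prop) _ _), intervalIntegral.integral_const_mul, hint]
    simp [besselIntegral, he]
  rw [hkey]
  have hle : ∀ x, ‖((w x : ℂ) * e x - Complex.I * (Q' x * e x))‖ ≤ 2 * w x := by
    intro x
    have hw0 : 0 ≤ w x := by simp only [hw]; positivity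
    have hQw : |Q' x| ≤ w x := by
      have hp : 0 ≤ τ * (Real.sin x - σ) ^ 2 := by positivity
      simp only [hQ', hw]
      generalize τ * (Real.sin x - σ) ^ 2 = y at hp ⊢
      rw [abs_div, abs_mul, abs_of_nonneg (show 0 ≤ (1 + y) ^ 2 by positivity),
        div_le_div_iff₀ (by positivity) (by positivity)]
      have h1 : |1 - y| ≤ 1 + y := by rw [abs_le]; constructor <;> linarith
      have h2 := mul_le_mul (Real.abs_cos_le_one x) h1 (abs_nonneg _) zero_le_one
      nlinarith
    refine (norm_sub_le _ _).trans ?_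
    simp only [norm_mul, Complex.norm_I, hen, Complex.norm_real, Real.norm_eq_abs, mul_one, one_mul,
      abs_of_nonneg hw0]
    linarith
  calc _ ≤ ∫ x in (-(Real.pi / 2))..(3 * Real.pi / 2), 2 * w x :=
        intervalIntegral.norm_integral_le_of_norm_le (by linarith)
          (Eventually.of_forall fun x _ => hle x) ((hwc.const_mul 2).intervalIntegrable _ _)
    _ ≤ _ := by
        rw [intervalIntegral.integral_const_mul]
        linarith [integral_inv_one_add_le hτ hσ]

theorem norm_besselIntegral_le_div_sqrt {k : ℤ} {τ : ℝ} (hτ : 1 ≤ τ) (hk : |(k : ℝ)| ≤ τ / 2) :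
    ‖besselIntegral k τ‖ ≤ 140 / √τ := by
  have h0 : 0 < τ := by linarith
  have h1 : 1 ≤ √τ := Real.one_le_sqrt.2 hτ
  refine (norm_besselIntegral_le h0 hk).trans ?_
  have h2 : 18 * Real.pi / τ ≤ 18 * Real.pi / √τ := by
    have := Real.pi_pos
    gcongr
    exact Real.sqrt_le_iff.2 ⟨h0.le, by nlinarith⟩
  calc _ ≤ 2 * (4 * (Real.pi / √τ) + 18 * Real.pi / √τ) := by linarith
    _ = 44 * Real.pi / √τ := by ring
    _ ≤ _ := by
      gcongr
      linarith [Real.pi_lt_d2]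

/-! ### The free evolution and its kernel on the torus. -/

theorem adjoint_latticeShift {d : ℕ} (v : Fin d → ℤ) :
    ContinuousLinearMap.adjoint (latticeShift v) = latticeShift (-v) := by
  symm
  rw [ContinuousLinearMap.eq_adjoint_iff]
  intro f g
  rw [lp.inner_eq_tsum, lp.inner_eq_tsum, ← (Equiv.addRight v).tsum_eq]
  simp [latticeShift_apply]

theorem isSelfAdjoint_freeHamiltonian (d : ℕ) : IsSelfAdjoint (freeHamiltonian d) := by
  rw [IsSelfAdjoint, freeHamiltonian, star_sub, star_smul, star_smul, star_sum]
  simp only [star_add, ContinuousLinearMap.star_eq_adjoint, adjoint_latticeShift, neg_neg,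
    ContinuousLinearMap.adjoint_id]
  congr 2
  · simp
  · simp
  · simp only [add_comm]

/-- The evolution group `exp(-itĤ₀)`. -/
noncomputable def freeEvolution (d : ℕ) (t : ℝ) : LatticeL2 d →L[ℂ] LatticeL2 d :=
  NormedSpace.exp ((t : ℂ) • ((-Complex.I) • freeHamiltonian d))

theorem freeEvolution_mem_unitary (d : ℕ) (t : ℝ) :
    freeEvolution d t ∈ unitary (LatticeL2 d →L[ℂ] LatticeL2 d) := by
  let _ : NormedAlgebra ℚ (LatticeL2 d →L[ℂ] LatticeL2 d) := NormedAlgebra.restrictScalars ℚ ℂ _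
  refine NormedSpace.exp_mem_unitary_of_mem_skewAdjoint ?_
  rw [skewAdjoint.mem_iff, star_smul, star_smul, (isSelfAdjoint_freeHamiltonian d).star_eq]
  simp

theorem norm_freeEvolution_apply (d : ℕ) (t : ℝ) (f : LatticeL2 d) :
    ‖freeEvolution d t f‖ = ‖f‖ :=
  ContinuousLinearMap.norm_map_of_mem_unitary (freeEvolution_mem_unitary d t) f

/-- Lebesgue measure on a fundamental cube of the torus dual to `ℤᵈ`. -/
noncomputable def momentumMeasure (d : ℕ) : MeasureTheory.Measure (Fin d → ℝ) :=
  MeasureTheory.Measure.pi fun _ =>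
    MeasureTheory.volume.restrict (Set.Ioc (-(Real.pi / 2)) (3 * Real.pi / 2))

instance isFiniteMeasure_momentumMeasure (d : ℕ) :
    MeasureTheory.IsFiniteMeasure (momentumMeasure d) := by
  unfold momentumMeasure
  infer_instance

/-- The symbol `∑ⱼ (1 - cos xⱼ)/2` of the free Hamiltonian. -/
noncomputable def latticeSymbol {d : ℕ} (x : Fin d → ℝ) : ℝ := ∑ j, (1 - Real.cos (x j)) / 2

/-- The character `exp(i n·x)`. -/
noncomputable def latticeChar {d : ℕ} (n : Fin d → ℤ) (x : Fin d → ℝ) : ℂ :=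
  Complex.exp (((∑ j, (n j : ℝ) * x j : ℝ) : ℂ) * Complex.I)

theorem norm_latticeChar {d : ℕ} (n : Fin d → ℤ) (x : Fin d → ℝ) : ‖latticeChar n x‖ = 1 :=
  Complex.norm_exp_ofReal_mul_I _

theorem continuous_latticeChar {d : ℕ} (n : Fin d → ℤ) : Continuous (latticeChar n) := by
  unfold latticeChar
  fun_prop

theorem continuous_latticeSymbol {d : ℕ} : Continuous (latticeSymbol (d := d)) := by
  unfold latticeSymbol
  fun_prop

theorem abs_latticeSymbol_le {d : ℕ} (x : Fin d → ℝ) : |latticeSymbol x| ≤ d := by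
  refine (Finset.abs_sum_le_sum_abs _ _).trans ?_
  calc _ ≤ ∑ _j : Fin d, (1 : ℝ) := Finset.sum_le_sum fun j _ => by
        rw [abs_le]
        constructor <;> linarith [Real.cos_le_one (x j), Real.neg_one_le_cos (x j)]
    _ = d := by simp

theorem latticeChar_add {d : ℕ} (n m : Fin d → ℤ) (x : Fin d → ℝ) :
    latticeChar (n + m) x = latticeChar n x * latticeChar m x := by
  simp only [latticeChar, ← Complex.exp_add, ← add_mul, ← Complex.ofReal_add,
    ← Finset.sum_add_distrib, Pi.add_apply, Int.cast_add]

theorem latticeChar_add_single {d : ℕ} (n : Fin d → ℤ) (j : Fin d) (x : Fin d → ℝ) :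
    latticeChar (n + Pi.single j 1) x + latticeChar (n - Pi.single j 1) x =
      2 * Real.cos (x j) * latticeChar n x := by
  have h : ∀ c : ℤ, latticeChar (Pi.single j c) x = Complex.exp (c * x j * Complex.I) := by
    intro c
    rw [latticeChar, Finset.sum_eq_single j]
    · simp
    · intro i _ hi; simp [hi]
    · simp
  rw [sub_eq_add_neg, ← Pi.single_neg, latticeChar_add, latticeChar_add, h, h, Complex.ofReal_cos,
    Complex.two_cos]
  push_cast
  ring_nf

theorem symbol_mul_latticeChar {d : ℕ} (n : Fin d → ℤ) (x : Fin d → ℝ) :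
    (latticeSymbol x : ℂ) * latticeChar n x = (d : ℂ) / 2 * latticeChar n x -
      1 / 4 * ∑ j, (latticeChar (n + Pi.single j 1) x + latticeChar (n - Pi.single j 1) x) := by
  simp only [latticeChar_add_single, latticeSymbol, ← Finset.sum_mul]
  rw [← Finset.sum_div, Finset.sum_sub_distrib, ← Finset.mul_sum]
  push_cast
  simp
  ring

theorem latticeChar_eq_prod {d : ℕ} (n : Fin d → ℤ) (x : Fin d → ℝ) :
    latticeChar n x = ∏ j, Complex.exp ((((n j : ℝ) * x j : ℝ) : ℂ) * Complex.I) := by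
  rw [latticeChar, ← Complex.exp_sum, ← Finset.sum_mul, Complex.ofReal_sum]

theorem integrable_symbol_pow_mul {d : ℕ} (k : ℕ) (n : Fin d → ℤ) :
    MeasureTheory.Integrable (fun x => (latticeSymbol x : ℂ) ^ k * latticeChar n x)
      (momentumMeasure d) := by
  refine MeasureTheory.Integrable.of_bound (C := (d : ℝ) ^ k) ?_ (Eventually.of_forall fun x => ?_)
  · have h1 := continuous_latticeSymbol (d := d)
    have h2 := continuous_latticeChar n
    exact Continuous.aestronglyMeasurable (by fun_prop)
  · rw [norm_mul, norm_latticeChar, mul_one, norm_pow, Complex.norm_real, Real.norm_eq_abs]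
    exact pow_le_pow_left₀ (abs_nonneg _) (abs_latticeSymbol_le x) k

theorem integral_exp_int (k : ℤ) :
    ∫ x in (-(Real.pi / 2))..(3 * Real.pi / 2), Complex.exp (((k * x : ℝ) : ℂ) * Complex.I) =
      if k = 0 then 2 * (Real.pi : ℂ) else 0 := by
  split_ifs with hk
  · simp [hk]
    ring
  · have hc : (k : ℂ) * Complex.I ≠ 0 := by simp [hk]
    have h : ∀ x : ℝ, (((k * x : ℝ) : ℂ) * Complex.I) = ((k : ℂ) * Complex.I) * x := by
      intro x; push_cast; ring
    simp only [h]
    rw [integral_exp_mul_complex hc]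
    rw [div_eq_zero_iff, sub_eq_zero]
    left
    rw [Complex.exp_eq_exp_iff_exists_int]
    refine ⟨k, ?_⟩
    push_cast
    ring

theorem integral_momentum_prod {d : ℕ} (F : Fin d → ℝ → ℂ) :
    ∫ x, ∏ j, F j (x j) ∂(momentumMeasure d) =
      ∏ j, ∫ x in (-(Real.pi / 2))..(3 * Real.pi / 2), F j x := by
  have hpi := Real.pi_pos
  rw [momentumMeasure, MeasureTheory.integral_fintype_prod_eq_prod]
  refine Finset.prod_congr rfl fun j _ => ?_
  rw [intervalIntegral.integral_of_le (by linarith)]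

theorem integral_latticeChar {d : ℕ} (n : Fin d → ℤ) :
    ∫ x, latticeChar n x ∂(momentumMeasure d) = if n = 0 then (2 * (Real.pi : ℂ)) ^ d else 0 := by
  simp only [latticeChar_eq_prod]
  rw [integral_momentum_prod (fun j y => Complex.exp ((((n j : ℝ) * y : ℝ) : ℂ) * Complex.I))]
  simp only [integral_exp_int]
  split_ifs with h
  · simp [h]
  · obtain ⟨j, hj⟩ := Function.ne_iff.1 h
    exact Finset.prod_eq_zero (Finset.mem_univ j) (if_neg hj)

/-- Multiplication by the symbol acts on characters as the difference operator does, so induction on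
`k` gives the Fourier formula on basis vectors without constructing a Fourier transform. -/
theorem freeHamiltonian_pow_single {d : ℕ} (k : ℕ) (m n : Fin d → ℤ) :
    (2 * (Real.pi : ℂ)) ^ d * ((freeHamiltonian d) ^ k) (lp.single 2 m (1 : ℂ)) n =
      ∫ x, (latticeSymbol x : ℂ) ^ k * latticeChar (n - m) x ∂(momentumMeasure d) := by
  induction k generalizing n with
  | zero =>
    simp only [pow_zero, one_mul, integral_latticeChar, one_apply_eq_self, sub_eq_zero]
    by_cases h : n = m
    · subst h; simp
    · simp [h]
  | succ k ih =>
    have hI := integrable_symbol_pow_mul (d := d) k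
    have hsum : ∀ j : Fin d, MeasureTheory.Integrable (fun x => (latticeSymbol x : ℂ) ^ k *
        latticeChar (n - m + Pi.single j 1) x + (latticeSymbol x : ℂ) ^ k *
        latticeChar (n - m - Pi.single j 1) x) (momentumMeasure d) := fun j => (hI _).add (hI _)
    rw [pow_succ', mul_apply_eq_comp, freeHamiltonian_apply]
    have h1 : ∀ x : Fin d → ℝ, (latticeSymbol x : ℂ) ^ (k + 1) * latticeChar (n - m) x =
        (d : ℂ) / 2 * ((latticeSymbol x : ℂ) ^ k * latticeChar (n - m) x) -
        1 / 4 * ∑ j, ((latticeSymbol x : ℂ) ^ k * latticeChar (n - m + Pi.single j 1) x +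
          (latticeSymbol x : ℂ) ^ k * latticeChar (n - m - Pi.single j 1) x) := by
      intro x
      rw [pow_succ, mul_assoc, symbol_mul_latticeChar]
      simp only [← mul_add, ← Finset.mul_sum]
      ring
    simp only [h1]
    rw [MeasureTheory.integral_sub ((hI _).const_mul _)
      ((MeasureTheory.integrable_finsetSum _ fun j _ => hsum j).const_mul _),
      MeasureTheory.integral_const_mul, MeasureTheory.integral_const_mul,
      MeasureTheory.integral_finsetSum _ fun j _ => hsum j, mul_sub, mul_left_comm, ih,
      mul_left_comm, Finset.mul_sum]
    congr 2
    refine Finset.sum_congr rfl fun j _ => ?_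
    rw [MeasureTheory.integral_add (hI _) (hI _), mul_add, ih, ih]
    congr 4 <;> abel_nf

/-- Sum the formula for powers against the exponential series; the bound `d` on the symbol dominates
the exchange of sum and integral. -/
theorem freeEvolution_single {d : ℕ} (t : ℝ) (m n : Fin d → ℤ) :
    (2 * (Real.pi : ℂ)) ^ d * freeEvolution d t (lp.single 2 m (1 : ℂ)) n =
      ∫ x, Complex.exp (-(t * Complex.I) * latticeSymbol x) * latticeChar (n - m) x
        ∂(momentumMeasure d) := by
  have h1 := NormedSpace.exp_series_hasSum_exp' (𝕂 := ℂ)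
    ((t : ℂ) • ((-Complex.I) • freeHamiltonian d))
  have h2 := ((((lp.evalCLM ℂ (fun _ : Fin d → ℤ => ℂ) 2 n).comp
    (ContinuousLinearMap.apply ℂ (LatticeL2 d) (lp.single 2 m (1 : ℂ)))).hasSum h1).mul_left
      ((2 * (Real.pi : ℂ)) ^ d))
  have h3 : HasSum (fun k : ℕ => ∫ x, ((k.factorial : ℂ)⁻¹ * (-(t * Complex.I)) ^ k) *
      ((latticeSymbol x : ℂ) ^ k * latticeChar (n - m) x) ∂(momentumMeasure d))
      (∫ x, Complex.exp (-(t * Complex.I) * latticeSymbol x) * latticeChar (n - m) x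
        ∂(momentumMeasure d)) := by
    have hs := NormedSpace.exp_series_hasSum_exp' (𝕂 := ℝ) (|t| * d : ℝ)
    refine MeasureTheory.hasSum_integral_of_dominated_convergence
      (fun k _ => (k.factorial : ℝ)⁻¹ • (|t| * d) ^ k)
      (fun k => ((integrable_symbol_pow_mul k _).const_mul _).1)
      (fun k => Eventually.of_forall fun x => ?_) (Eventually.of_forall fun x => hs.summable)
      (MeasureTheory.integrable_const _) (Eventually.of_forall fun x => ?_)
    · simp only [norm_mul, norm_pow, norm_latticeChar, mul_one, norm_inv, norm_neg,
        Complex.norm_natCast, Complex.norm_I, Complex.norm_real, Real.norm_eq_abs, smul_eq_mul,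
        mul_assoc, ← mul_pow]
      gcongr
      exact abs_latticeSymbol_le x
    · have h4 := (NormedSpace.exp_series_hasSum_exp' (𝕂 := ℂ)
        (-(t * Complex.I) * latticeSymbol x)).mul_right (latticeChar (n - m) x)
      rw [← Complex.exp_eq_exp_ℂ] at h4
      refine h4.congr_fun ?_
      intro k
      rw [smul_eq_mul, mul_pow]
      ring
  refine (h2.unique (h3.congr_fun ?_))
  intro k
  rw [MeasureTheory.integral_const_mul, ← freeHamiltonian_pow_single]
  simp only [ContinuousLinearMap.comp_apply, ContinuousLinearMap.apply_apply, smul_smul, smul_pow,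
    map_smul, smul_eq_mul]
  change _ * (_ * ((freeHamiltonian d ^ k) (lp.single 2 m (1 : ℂ))) n) = _
  ring

/-- The symbol is a sum over coordinates, so the integral factorises; the constant part of the
symbol contributes only a unimodular phase. -/
theorem norm_freeEvolution_single {d : ℕ} (t : ℝ) (m n : Fin d → ℤ) :
    (2 * Real.pi) ^ d * ‖freeEvolution d t (lp.single 2 m (1 : ℂ)) n‖ =
      ∏ j, ‖besselIntegral (n j - m j) (t / 2)‖ := by
  have h := congrArg norm (freeEvolution_single t m n)
  have h1 : ∀ x : Fin d → ℝ, Complex.exp (-(t * Complex.I) * latticeSymbol x) *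
      latticeChar (n - m) x = ∏ j, Complex.exp (-(t * Complex.I) / 2) * Complex.exp
        (((((n j - m j : ℤ) : ℝ) * x j + t / 2 * Real.cos (x j) : ℝ) : ℂ) * Complex.I) := by
    intro x
    rw [latticeChar_eq_prod, latticeSymbol, Complex.ofReal_sum, Finset.mul_sum, Complex.exp_sum,
      ← Finset.prod_mul_distrib]
    refine Finset.prod_congr rfl fun j _ => ?_
    rw [← Complex.exp_add, ← Complex.exp_add, Pi.sub_apply]
    congr 1
    push_cast
    ring
  simp only [h1] at h
  rw [integral_momentum_prod (fun j y => Complex.exp (-(t * Complex.I) / 2) * Complex.exp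
        (((((n j - m j : ℤ) : ℝ) * y + t / 2 * Real.cos y : ℝ) : ℂ) * Complex.I)),
    norm_mul, norm_pow, norm_prod] at h
  have h2 : ‖Complex.exp (-(t * Complex.I) / 2)‖ = 1 := by
    rw [show -(t * Complex.I) / 2 = ((-t / 2 : ℝ) : ℂ) * Complex.I by push_cast; ring]
    exact Complex.norm_exp_ofReal_mul_I _
  have h3 : ‖(2 * (Real.pi : ℂ))‖ = 2 * Real.pi := by
    rw [norm_mul, Complex.norm_real, Real.norm_eq_abs, abs_of_pos Real.pi_pos]
    simp
  rw [h3] at h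
  rw [h]
  refine Finset.prod_congr rfl fun j _ => ?_
  rw [intervalIntegral.integral_const_mul, norm_mul, h2, one_mul, besselIntegral]

theorem norm_freeEvolution_single_le {d : ℕ} {t : ℝ} (ht : 2 ≤ t) {m n : Fin d → ℤ}
    (h : ∀ j, |((n j - m j : ℤ) : ℝ)| ≤ t / 4) :
    ‖freeEvolution d t (lp.single 2 m (1 : ℂ)) n‖ ≤ (200 / √t) ^ d := by
  have h1 : 1 ≤ (2 * Real.pi) ^ d := one_le_pow₀ (by linarith [Real.pi_gt_three])
  calc _ ≤ (2 * Real.pi) ^ d * ‖freeEvolution d t (lp.single 2 m (1 : ℂ)) n‖ :=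
        le_mul_of_one_le_left (norm_nonneg _) h1
    _ = ∏ j, ‖besselIntegral (n j - m j) (t / 2)‖ := norm_freeEvolution_single t m n
    _ ≤ ∏ _j : Fin d, 200 / √t := by
        refine Finset.prod_le_prod (fun _ _ => norm_nonneg _) fun j _ => ?_
        refine (norm_besselIntegral_le_div_sqrt (by linarith) (by linarith [h j])).trans ?_
        rw [Real.sqrt_div (by linarith), div_div_eq_mul_div]
        gcongr
        have : √2 ≤ 200 / 140 := Real.sqrt_le_iff.2 ⟨by norm_num, by norm_num⟩
        linarith
    _ = _ := by rw [Finset.prod_const, Finset.card_univ, Fintype.card_fin]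

/-! ### Dyadic shell decomposition. -/

/-- The index of the dyadic shell `2^(k-1) ≤ |n|_∞ < 2^k` containing the lattice point `n`. -/
def shellIndex {d : ℕ} (n : Fin d → ℤ) : ℕ := Nat.size (Finset.univ.sup fun j => (n j).natAbs)

theorem abs_lt_two_pow_shellIndex {d : ℕ} (n : Fin d → ℤ) (j : Fin d) :
    |n j| < 2 ^ shellIndex n := by
  have h1 := Nat.lt_size_self (Finset.univ.sup fun j => (n j).natAbs)
  have h2 := Finset.le_sup (f := fun j => (n j).natAbs) (Finset.mem_univ j)
  rw [← Int.natCast_natAbs]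
  exact_mod_cast h2.trans_lt h1

theorem abs_le_latticeNorm {d : ℕ} (n : Fin d → ℤ) (j : Fin d) : |(n j : ℝ)| ≤ latticeNorm n := by
  rw [latticeNorm, ← Real.sqrt_sq_eq_abs]
  exact Real.sqrt_le_sqrt (Finset.single_le_sum (f := fun i => (n i : ℝ) ^ 2)
    (fun i _ => sq_nonneg _) (Finset.mem_univ j))

theorem two_pow_shellIndex_le {d : ℕ} (n : Fin d → ℤ) (hn : 1 ≤ latticeNorm n) :
    (2 : ℝ) ^ shellIndex n ≤ 2 * latticeNorm n := by
  rcases Nat.eq_zero_or_pos (shellIndex n) with h | h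
  · rw [h]; linarith
  · have h1 : 2 ^ (shellIndex n - 1) ≤ Finset.univ.sup fun j => (n j).natAbs :=
      Nat.lt_size.1 (Nat.sub_lt h one_pos)
    have h2 : ((Finset.univ.sup fun j => (n j).natAbs : ℕ) : ℝ) ≤ latticeNorm n := by
      rcases isEmpty_or_nonempty (Fin d) with hd | hd
      · simp [latticeNorm]
      · obtain ⟨j, _, hj⟩ := Finset.exists_mem_eq_sup Finset.univ Finset.univ_nonempty
          fun j => (n j).natAbs
        rw [hj, Nat.cast_natAbs, Int.cast_abs]
        exact abs_le_latticeNorm n j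
    calc (2 : ℝ) ^ shellIndex n = 2 * 2 ^ (shellIndex n - 1) := by
          rw [← pow_succ', Nat.sub_add_cancel h]
      _ ≤ 2 * latticeNorm n := by
          have : (2 : ℝ) ^ (shellIndex n - 1) ≤
              ((Finset.univ.sup fun j => (n j).natAbs : ℕ) : ℝ) := by exact_mod_cast h1
          linarith

/-- The points of the `k`-th dyadic shell. -/
noncomputable def shell (d k : ℕ) : Finset (Fin d → ℤ) :=
  (Fintype.piFinset fun _ => Finset.Icc (-2 ^ k : ℤ) (2 ^ k)).filter fun n => shellIndex n = k

theorem mem_shell {d k : ℕ} {n : Fin d → ℤ} : n ∈ shell d k ↔ shellIndex n = k := by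
  simp only [shell, Finset.mem_filter, Fintype.mem_piFinset, Finset.mem_Icc, and_iff_right_iff_imp]
  rintro rfl j
  have := abs_lt.1 (abs_lt_two_pow_shellIndex n j)
  exact ⟨this.1.le, this.2.le⟩

theorem card_shell_le (d k : ℕ) : ((shell d k).card : ℝ) ≤ (3 * 2 ^ k) ^ d := by
  have h : (shell d k).card ≤ (3 * 2 ^ k) ^ d := by
    refine (Finset.card_filter_le _ _).trans ?_
    rw [Fintype.card_piFinset, Finset.prod_const, Finset.card_univ, Fintype.card_fin, Int.card_Icc]
    refine Nat.pow_le_pow_left ?_ d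
    have : (0 : ℤ) < 2 ^ k := by positivity
    zify
    rw [Int.toNat_of_nonneg] <;> linarith
  exact_mod_cast h

/-- The restriction of `f` to the `k`-th dyadic shell. -/
noncomputable def shellPart {d : ℕ} (k : ℕ) (f : LatticeL2 d) : LatticeL2 d :=
  ∑ n ∈ shell d k, lp.single 2 n (f n)

theorem norm_shellPart_sq {d : ℕ} (k : ℕ) (f : LatticeL2 d) :
    ‖shellPart k f‖ ^ 2 = ∑ n ∈ shell d k, ‖f n‖ ^ 2 := by
  have h := lp.norm_sum_single (E := fun _ : Fin d → ℤ => ℂ) (p := 2) (by norm_num) f (shell d k)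
  simpa [shellPart] using h

theorem norm_shellPart_le {d : ℕ} (k : ℕ) (f : LatticeL2 d) : ‖shellPart k f‖ ≤ ‖f‖ := by
  have h := lp.sum_rpow_le_norm_rpow (p := 2) (by norm_num) f (shell d k)
  refine le_of_sq_le_sq ?_ (norm_nonneg _)
  rw [norm_shellPart_sq]
  simpa using h

theorem norm_shellPart_le_mul {d : ℕ} {k : ℕ} {f g : LatticeL2 d} {c : ℝ} (hc : 0 ≤ c)
    (h : ∀ n, shellIndex n = k → ‖g n‖ ≤ c * ‖f n‖) : ‖shellPart k g‖ ≤ c * ‖shellPart k f‖ := by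
  refine le_of_sq_le_sq ?_ (by positivity)
  rw [mul_pow, norm_shellPart_sq, norm_shellPart_sq, Finset.mul_sum]
  refine Finset.sum_le_sum fun n hn => ?_
  rw [← mul_pow]
  exact pow_le_pow_left₀ (norm_nonneg _) (h n (mem_shell.1 hn)) 2

theorem inner_shellPart {d : ℕ} (k : ℕ) (f g : LatticeL2 d) :
    inner ℂ (shellPart k f) g = ∑ n ∈ shell d k, inner ℂ (f n) (g n) := by
  rw [shellPart, sum_inner]
  exact Finset.sum_congr rfl fun n _ =>
    lp.inner_single_left (𝕜 := ℂ) (G := fun _ : Fin d → ℤ => ℂ) n (f n) g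

theorem inner_shellPart_self {d : ℕ} (k : ℕ) (f : LatticeL2 d) :
    ‖inner ℂ (shellPart k f) f‖ = ‖shellPart k f‖ ^ 2 := by
  rw [inner_shellPart, norm_shellPart_sq]
  have h : ∑ n ∈ shell d k, inner ℂ (f n) (f n) =
      ((∑ n ∈ shell d k, ‖f n‖ ^ 2 : ℝ) : ℂ) := by
    rw [Complex.ofReal_sum]
    refine Finset.sum_congr rfl fun n _ => ?_
    rw [inner_self_eq_norm_sq_to_K, Complex.ofReal_pow]
    rfl
  rw [h, Complex.norm_real, Real.norm_of_nonneg (Finset.sum_nonneg fun n _ => sq_nonneg _)]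

theorem hasSum_shellPart {d : ℕ} (f : LatticeL2 d) : HasSum (fun k => shellPart k f) f := by
  have h := lp.hasSum_single (p := 2) (by norm_num) f
  rw [← (Equiv.sigmaFiberEquiv (shellIndex (d := d))).hasSum_iff] at h
  refine h.sigma fun k => ?_
  have h1 := Finset.hasSum (shell d k) fun n => (lp.single 2 n (f n) : LatticeL2 d)
  exact (Equiv.subtypeEquivRight (p := fun n => shellIndex n = k)
    (q := fun n => n ∈ (shell d k : Set (Fin d → ℤ))) fun n => mem_shell.symm).hasSum_iff.2 h1

theorem tendsto_sum_shellPart {d : ℕ} (f : LatticeL2 d) :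
    Tendsto (fun N => ‖f - ∑ k ∈ Finset.range N, shellPart k f‖) atTop (nhds 0) := by
  have h := ((hasSum_shellPart f).tendsto_sum_nat.const_sub f).norm
  simpa using h

theorem sum_norm_shell_le {d : ℕ} (k : ℕ) (f : LatticeL2 d) :
    ∑ n ∈ shell d k, ‖f n‖ ≤ √((3 * 2 ^ k) ^ d) * ‖shellPart k f‖ := by
  refine le_of_sq_le_sq ?_ (by positivity)
  rw [mul_pow, Real.sq_sqrt (by positivity), norm_shellPart_sq]
  refine (sq_sum_le_card_mul_sum_sq).trans ?_
  gcongr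
  exact card_shell_le d k

theorem inner_shellPart_apply_shellPart {d : ℕ} (j k : ℕ) (f g : LatticeL2 d)
    (T : LatticeL2 d →L[ℂ] LatticeL2 d) :
    inner ℂ (shellPart j f) (T (shellPart k g)) =
      ∑ n ∈ shell d j, ∑ m ∈ shell d k, inner ℂ (f n) (g m * T (lp.single 2 m (1 : ℂ)) n) := by
  rw [inner_shellPart]
  refine Finset.sum_congr rfl fun n _ => ?_
  rw [shellPart, map_sum, lp.coeFn_sum, Finset.sum_apply, inner_sum]
  refine Finset.sum_congr rfl fun m _ => ?_
  have h : (lp.single 2 m (g m) : LatticeL2 d) = g m • lp.single 2 m (1 : ℂ) := by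
    rw [← lp.single_smul, smul_eq_mul, mul_one]
  rw [h, map_smul]
  rfl

/-- Cauchy–Schwarz on each shell turns a pointwise kernel bound into an `ℓ²` bound, at the cost of
the square roots of the cardinality bounds. -/
theorem norm_inner_shellPart_le_of_kernel {d : ℕ} {j k : ℕ} (f g : LatticeL2 d)
    {T : LatticeL2 d →L[ℂ] LatticeL2 d} {c : ℝ} (hc : 0 ≤ c)
    (hT : ∀ n ∈ shell d j, ∀ m ∈ shell d k, ‖T (lp.single 2 m (1 : ℂ)) n‖ ≤ c) :
    ‖inner ℂ (shellPart j f) (T (shellPart k g))‖ ≤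
      c * (√((3 * 2 ^ j) ^ d) * √((3 * 2 ^ k) ^ d)) * (‖shellPart j f‖ * ‖shellPart k g‖) := by
  rw [inner_shellPart_apply_shellPart]
  calc _ ≤ ∑ n ∈ shell d j, ∑ m ∈ shell d k, ‖f n‖ * (‖g m‖ * c) := by
        refine norm_sum_le_of_le _ fun n hn => norm_sum_le_of_le _ fun m hm => ?_
        refine (norm_inner_le_norm _ _).trans ?_
        rw [norm_mul]
        gcongr
        exact hT n hn m hm
    _ = c * ((∑ n ∈ shell d j, ‖f n‖) * ∑ m ∈ shell d k, ‖g m‖) := by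
        rw [Finset.sum_mul_sum, Finset.mul_sum]
        refine Finset.sum_congr rfl fun n _ => ?_
        rw [Finset.mul_sum]
        exact Finset.sum_congr rfl fun m _ => by ring
    _ ≤ c * ((√((3 * 2 ^ j) ^ d) * ‖shellPart j f‖) * (√((3 * 2 ^ k) ^ d) * ‖shellPart k g‖)) := by
        gcongr
        · exact sum_norm_shell_le j f
        · exact sum_norm_shell_le k g
    _ = _ := by ring

/-! ### Dispersive estimates between shells. -/

/-- The decay profile `(1 + t/L)^(-3/2)`. -/
noncomputable def dispersiveDecay (L t : ℝ) : ℝ := ((√(1 + t / L)) ^ 3)⁻¹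

/-- With `L = 2^(j+k)`, unitarity suffices for `t ≤ 16L`. For later times both shells lie within the
range of the kernel bound, and the factor `(3√L)^d` from the cardinalities combines with
`(200/√t)^d`; since `L ≤ t`, the power `d` may be lowered to `3`. -/
theorem norm_inner_freeEvolution_le {d : ℕ} (hd : 3 ≤ d) (j k : ℕ) (f g : LatticeL2 d) {t : ℝ}
    (ht : 0 ≤ t) :
    ‖inner ℂ (shellPart j f) (freeEvolution d t (shellPart k g))‖ ≤
      3 * 600 ^ d * dispersiveDecay (2 ^ (j + k)) t * (‖shellPart j f‖ * ‖shellPart k g‖) := by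
  set L : ℝ := 2 ^ (j + k) with hL
  have hL1 : 1 ≤ L := one_le_pow₀ (by norm_num)
  have hL0 : 0 < L := by linarith
  have hq : 0 < √(1 + t / L) := Real.sqrt_pos.2 (by positivity)
  have h600 : (600 : ℝ) ^ 3 ≤ 600 ^ d := pow_le_pow_right₀ (by norm_num) hd
  rcases le_total t (16 * L) with h | h
  · have h1 : 1 ≤ 3 * 600 ^ d * dispersiveDecay L t := by
      rw [dispersiveDecay, ← div_eq_mul_inv, one_le_div (by positivity)]
      have h2 : √(1 + t / L) ≤ 5 := by
        rw [Real.sqrt_le_iff]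
        refine ⟨by norm_num, ?_⟩
        have : t / L ≤ 16 := (div_le_iff₀ hL0).2 h
        linarith
      calc _ ≤ (5 : ℝ) ^ 3 := pow_le_pow_left₀ hq.le h2 3
        _ ≤ _ := by linarith
    refine (norm_inner_le_norm _ _).trans ?_
    rw [norm_freeEvolution_apply]
    exact le_mul_of_one_le_left (by positivity) h1
  · have ht0 : 0 < t := by linarith
    refine (norm_inner_shellPart_le_of_kernel f g (c := (200 / √t) ^ d) (by positivity) ?_).trans ?_
    · intro n hn m hm
      refine norm_freeEvolution_single_le (by linarith) fun i => ?_
      have h1 := abs_lt_two_pow_shellIndex n i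
      have h2 := abs_lt_two_pow_shellIndex m i
      rw [mem_shell.1 hn] at h1
      rw [mem_shell.1 hm] at h2
      have h3 : |n i - m i| ≤ 2 ^ j + 2 ^ k := (abs_sub _ _).trans (by linarith)
      have h4 : ((|n i - m i| : ℤ) : ℝ) ≤ ((2 ^ j + 2 ^ k : ℤ) : ℝ) := by exact_mod_cast h3
      push_cast at h4
      have hj : (1 : ℝ) ≤ 2 ^ j := one_le_pow₀ (by norm_num)
      have hk : (1 : ℝ) ≤ 2 ^ k := one_le_pow₀ (by norm_num)
      rw [pow_add] at hL
      push_cast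
      nlinarith
    · refine mul_le_mul_of_nonneg_right ?_ (by positivity)
      have hs : √((3 * 2 ^ j) ^ d) * √((3 * 2 ^ k) ^ d) = (3 * √L) ^ d := by
        rw [← Real.sqrt_mul (by positivity), ← mul_pow,
          show (3 * 2 ^ j * (3 * 2 ^ k) : ℝ) = (3 * √L) ^ 2 by
            rw [mul_pow, Real.sq_sqrt hL0.le, hL, pow_add]; ring,
          ← pow_mul, mul_comm 2 d, pow_mul, Real.sqrt_sq (by positivity)]
      have hr : √L / √t ≤ 1 := (div_le_one (Real.sqrt_pos.2 ht0)).2 (Real.sqrt_le_sqrt (by linarith))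
      rw [hs, ← mul_pow, show 200 / √t * (3 * √L) = 600 * (√L / √t) by ring, mul_pow]
      have h5 : (√L / √t) ^ d ≤ (√L / √t) ^ 3 := pow_le_pow_of_le_one (by positivity) hr hd
      have h6 : √L / √t ≤ √2 / √(1 + t / L) := by
        rw [← Real.sqrt_div hL0.le, ← Real.sqrt_div (by norm_num)]
        refine Real.sqrt_le_sqrt ?_
        rw [div_le_div_iff₀ ht0 (by positivity), mul_add, mul_div_cancel₀ _ hL0.ne']
        linarith
      have h7 : √2 ^ 3 ≤ 3 := by
        have h8 : √2 ≤ 3 / 2 := Real.sqrt_le_iff.2 ⟨by norm_num, by norm_num⟩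
        have h9 : √2 ^ 2 = 2 := Real.sq_sqrt (by norm_num)
        calc √2 ^ 3 = √2 ^ 2 * √2 := by ring
          _ ≤ 3 := by rw [h9]; linarith
      calc 600 ^ d * (√L / √t) ^ d ≤ 600 ^ d * (√2 / √(1 + t / L)) ^ 3 := by
            gcongr
            exact h5.trans (pow_le_pow_left₀ (by positivity) h6 3)
        _ = 600 ^ d * (√2 ^ 3 * dispersiveDecay L t) := by
            rw [div_pow, dispersiveDecay, div_eq_mul_inv]
        _ ≤ 600 ^ d * (3 * dispersiveDecay L t) := by
            have : 0 ≤ dispersiveDecay L t := by unfold dispersiveDecay; positivity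
            gcongr
        _ = _ := by ring

theorem hasDerivAt_dispersiveDecay_primitive {L t : ℝ} (hL : 0 < L) (ht : 0 ≤ t) :
    HasDerivAt (fun t => 2 * L * (1 - (√(1 + t / L))⁻¹)) (dispersiveDecay L t) t := by
  have h0 : 0 < 1 + t / L := by positivity
  have hs : 0 < √(1 + t / L) := Real.sqrt_pos.2 h0
  have h := ((((((hasDerivAt_id t).div_const L).const_add 1).sqrt h0.ne').inv
    hs.ne').const_sub 1).const_mul (2 * L)
  refine h.congr_deriv ?_
  simp only [id, dispersiveDecay]
  field_simp

theorem tendsto_dispersiveDecay {L : ℝ} (hL : 0 < L) :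
    Tendsto (dispersiveDecay L) atTop (nhds 0) := by
  unfold dispersiveDecay
  refine tendsto_inv_atTop_zero.comp ((tendsto_pow_atTop three_ne_zero).comp
    (Real.tendsto_sqrt_atTop.comp ?_))
  exact tendsto_atTop_add_const_left _ _ (tendsto_id.atTop_div_const hL)

/-- Only finitely many shells of `h` are treated dispersively; unitarity controls the tail uniformly
in `t`. -/
theorem norm_inner_freeEvolution_le_sum {d : ℕ} (hd : 3 ≤ d) (j N : ℕ) (f h : LatticeL2 d) {t : ℝ}
    (ht : 0 ≤ t) :
    ‖inner ℂ (shellPart j f) (freeEvolution d t h)‖ ≤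
      ∑ k ∈ Finset.range N, 3 * 600 ^ d * (‖shellPart j f‖ * ‖shellPart k h‖) *
        dispersiveDecay (2 ^ (j + k)) t +
      ‖shellPart j f‖ * ‖h - ∑ k ∈ Finset.range N, shellPart k h‖ := by
  have h1 : h = ∑ k ∈ Finset.range N, shellPart k h +
      (h - ∑ k ∈ Finset.range N, shellPart k h) := by abel
  conv_lhs => rw [h1]
  rw [map_add, map_sum, inner_add_right, inner_sum]
  refine (norm_add_le _ _).trans (add_le_add (norm_sum_le_of_le _ fun k _ => ?_) ?_)
  · refine (norm_inner_freeEvolution_le hd j k f h ht).trans_eq ?_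
    ring
  · refine (norm_inner_le_norm _ _).trans_eq ?_
    rw [norm_freeEvolution_apply]

theorem tendsto_inner_freeEvolution {d : ℕ} (hd : 3 ≤ d) (j : ℕ) (f h : LatticeL2 d) :
    Tendsto (fun t => ‖inner ℂ (shellPart j f) (freeEvolution d t h)‖) atTop (nhds 0) := by
  rw [Metric.tendsto_nhds]
  intro ε hε
  have h1 := (tendsto_sum_shellPart h).const_mul ‖shellPart j f‖
  rw [mul_zero] at h1
  obtain ⟨N, hN⟩ := (h1.eventually_lt_const (half_pos hε)).exists
  have h2 : Tendsto (fun t => ∑ k ∈ Finset.range N, 3 * 600 ^ d *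
      (‖shellPart j f‖ * ‖shellPart k h‖) * dispersiveDecay (2 ^ (j + k)) t) atTop (nhds 0) := by
    rw [← Finset.sum_const_zero (s := Finset.range N) (M := ℝ)]
    refine tendsto_finsetSum _ fun k _ => ?_
    have := (tendsto_dispersiveDecay (L := 2 ^ (j + k)) (by positivity)).const_mul
      (3 * 600 ^ d * (‖shellPart j f‖ * ‖shellPart k h‖))
    rwa [mul_zero] at this
  filter_upwards [h2.eventually_lt_const (half_pos hε), eventually_ge_atTop 0] with t ht ht0
  rw [Real.dist_0_eq_abs, abs_norm]
  exact (norm_inner_freeEvolution_le_sum hd j N f h ht0).trans_lt (by linarith)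

/-! ### Duhamel estimate for the shells of an approximate eigenvector. -/

theorem hasDerivAt_inner_freeEvolution {d : ℕ} (u f : LatticeL2 d) (E : ℂ) (t : ℝ) :
    HasDerivAt (fun t : ℝ => Complex.exp (t * (Complex.I * E)) *
        inner ℂ u (freeEvolution d t f))
      (-Complex.I * (Complex.exp (t * (Complex.I * E)) *
        inner ℂ u (freeEvolution d t (freeHamiltonian d f - E • f)))) t := by
  have h1 := hasDerivAt_exp_smul_const (𝕂 := ℂ) ((-Complex.I) • freeHamiltonian d) (t : ℂ)
  have h2 := (((innerSL ℂ u).comp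
    (ContinuousLinearMap.apply ℂ (LatticeL2 d) f)).hasFDerivAt.comp_hasDerivAt (t : ℂ) h1).comp_ofReal
  have h3 := (((hasDerivAt_id (t : ℂ)).mul_const (Complex.I * E)).cexp).comp_ofReal
  refine (h3.mul h2).congr_deriv ?_
  simp only [id, Function.comp, ContinuousLinearMap.comp_apply, ContinuousLinearMap.apply_apply,
    innerSL_apply_apply, mul_apply_eq_comp, smul_apply, map_smul, map_sub, inner_smul_right,
    inner_sub_right, one_mul]
  change _ + _ * (_ * inner ℂ u (freeEvolution d t _)) = _
  change _ * inner ℂ u (freeEvolution d t f) + _ = _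
  ring

theorem le_of_sq_le_mul {x B : ℝ} (hB : 0 ≤ B) (h : x ^ 2 ≤ B * x) : x ≤ B := by
  by_contra hlt
  nlinarith [not_le.1 hlt]

theorem norm_exp_mul_I_mul_le {E : ℂ} (hE : 0 ≤ E.im) {t : ℝ} (ht : 0 ≤ t) :
    ‖Complex.exp (t * (Complex.I * E))‖ ≤ 1 := by
  rw [Complex.norm_exp, Real.exp_le_one_iff]
  simp only [Complex.mul_re, Complex.ofReal_re, Complex.ofReal_im, Complex.I_re, Complex.I_im]
  nlinarith [mul_nonneg ht hE]

/-- The matrix element `exp(itE) ⟨P_j f, exp(-itĤ₀) f⟩`, constant in `t` if `Ĥ₀ f = E f`. -/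
noncomputable def shellAmplitude {d : ℕ} (j : ℕ) (f : LatticeL2 d) (E : ℂ) (t : ℝ) : ℂ :=
  Complex.exp (t * (Complex.I * E)) * inner ℂ (shellPart j f) (freeEvolution d t f)

/-- A mean value inequality replaces the Duhamel integral: the derivative is compared with that of
an explicit majorant, whose shell terms stay bounded by `2·2^(j+k)` times their coefficients. The
tail costs a term linear in `T`. -/
theorem norm_shellAmplitude_sub_le {d : ℕ} (hd : 3 ≤ d) (j N : ℕ) (f g : LatticeL2 d) {E : ℂ}
    (hE : 0 ≤ E.im) (hg : freeHamiltonian d f - E • f = g)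
    (hs : Summable fun k => 2 ^ k * ‖shellPart k g‖) {T : ℝ} (hT : 0 ≤ T) :
    ‖shellAmplitude j f E T - shellAmplitude j f E 0‖ ≤
      2 * (3 * 600 ^ d) * 2 ^ j * (∑' k, 2 ^ k * ‖shellPart k g‖) * ‖shellPart j f‖ +
      ‖shellPart j f‖ * ‖g - ∑ k ∈ Finset.range N, shellPart k g‖ * T := by
  set x := ‖shellPart j f‖ with hx
  have hderiv : ∀ t : ℝ, HasDerivAt (fun t => shellAmplitude j f E t - shellAmplitude j f E 0)
      (-Complex.I * (Complex.exp (t * (Complex.I * E)) *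
        inner ℂ (shellPart j f) (freeEvolution d t g))) t := fun t => by
    have := hasDerivAt_inner_freeEvolution (shellPart j f) f E t
    rw [hg] at this
    exact this.sub_const _
  have hB : ∀ t, 0 ≤ t → HasDerivAt (fun t => ∑ k ∈ Finset.range N, 3 * 600 ^ d *
        (x * ‖shellPart k g‖) * (2 * 2 ^ (j + k) * (1 - (√(1 + t / 2 ^ (j + k)))⁻¹)) +
        x * ‖g - ∑ k ∈ Finset.range N, shellPart k g‖ * t)
      (∑ k ∈ Finset.range N, 3 * 600 ^ d * (x * ‖shellPart k g‖) *
        dispersiveDecay (2 ^ (j + k)) t +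
        x * ‖g - ∑ k ∈ Finset.range N, shellPart k g‖) t := by
    intro t ht
    refine HasDerivAt.add (HasDerivAt.fun_sum fun k _ =>
      (hasDerivAt_dispersiveDecay_primitive (by positivity) ht).const_mul _) ?_
    simpa using (hasDerivAt_id t).const_mul
      (x * ‖g - ∑ k ∈ Finset.range N, shellPart k g‖)
  have hmv := image_norm_le_of_norm_deriv_right_le_deriv_boundary' (a := 0) (b := T)
    (fun t _ => (hderiv t).continuousAt.continuousWithinAt)
    (fun t _ => (hderiv t).hasDerivWithinAt)
    (by simp) (fun t ht => (hB t ht.1).continuousAt.continuousWithinAt)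
    (fun t ht => (hB t ht.1).hasDerivWithinAt)
    (fun t ht => by
      rw [norm_mul, norm_neg, Complex.norm_I, one_mul, norm_mul]
      exact (mul_le_of_le_one_left (norm_nonneg _) (norm_exp_mul_I_mul_le hE ht.1)).trans
        (norm_inner_freeEvolution_le_sum hd j N f _ ht.1)) ⟨hT, le_rfl⟩
  refine hmv.trans (add_le_add ?_ le_rfl)
  calc _ ≤ ∑ k ∈ Finset.range N, 2 * (3 * 600 ^ d) * 2 ^ j * x * (2 ^ k * ‖shellPart k g‖) := by
        refine Finset.sum_le_sum fun k _ => ?_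
        have h1 : 1 - (√(1 + T / 2 ^ (j + k)))⁻¹ ≤ 1 := by
          have : 0 ≤ (√(1 + T / 2 ^ (j + k)))⁻¹ := by positivity
          linarith
        calc _ ≤ 3 * 600 ^ d * (x * ‖shellPart k g‖) * (2 * 2 ^ (j + k) * 1) := by gcongr
          _ = _ := by ring
    _ ≤ 2 * (3 * 600 ^ d) * 2 ^ j * x * (∑' k, 2 ^ k * ‖shellPart k g‖) := by
        rw [← Finset.mul_sum]
        gcongr
        exact hs.sum_le_tsum _ fun k _ => by positivity
    _ = _ := by ring

theorem norm_shellPart_le_tsum {d : ℕ} (hd : 3 ≤ d) (j : ℕ) (f : LatticeL2 d) {E : ℂ}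
    (hE : 0 ≤ E.im)
    (hs : Summable fun k => 2 ^ k * ‖shellPart k (freeHamiltonian d f - E • f)‖) :
    ‖shellPart j f‖ ≤ 2 * (3 * 600 ^ d) * 2 ^ j *
      ∑' k, 2 ^ k * ‖shellPart k (freeHamiltonian d f - E • f)‖ := by
  set g := freeHamiltonian d f - E • f with hg
  set Z := ∑' k, 2 ^ k * ‖shellPart k g‖ with hZ
  set x := ‖shellPart j f‖ with hx
  have hstep : ∀ T : ℝ, 0 ≤ T → ‖shellAmplitude j f E T - shellAmplitude j f E 0‖ ≤
      2 * (3 * 600 ^ d) * 2 ^ j * Z * x := by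
    -- The limit `N → ∞` is taken at fixed `T`, before `T → ∞`, to remove the tail term linear in
    -- `T`.
    intro T hT
    have h1 := (((tendsto_sum_shellPart g).const_mul x).mul_const T).const_add
      (2 * (3 * 600 ^ d) * 2 ^ j * Z * x)
    rw [mul_zero, zero_mul, add_zero] at h1
    exact ge_of_tendsto' h1 fun N => norm_shellAmplitude_sub_le hd j N f g hE hg.symm hs hT
  have hF0 : ‖shellAmplitude j f E 0‖ = x ^ 2 := by
    simp only [shellAmplitude, freeEvolution, Complex.ofReal_zero, zero_mul, Complex.exp_zero,
      one_mul, zero_smul, NormedSpace.exp_zero, one_apply_eq_self]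
    exact inner_shellPart_self j f
  have hlim : x ^ 2 ≤ 2 * (3 * 600 ^ d) * 2 ^ j * Z * x := by
    have h1 := (tendsto_inner_freeEvolution hd j f f).const_add
      (2 * (3 * 600 ^ d) * 2 ^ j * Z * x)
    rw [add_zero] at h1
    refine ge_of_tendsto h1 ((eventually_ge_atTop 0).mono fun T hT => ?_)
    rw [← hF0]
    have h2 : ‖shellAmplitude j f E T‖ ≤ ‖inner ℂ (shellPart j f) (freeEvolution d T f)‖ := by
      simp only [shellAmplitude, norm_mul]
      exact mul_le_of_le_one_left (norm_nonneg _) (norm_exp_mul_I_mul_le hE hT)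
    have h3 : ‖shellAmplitude j f E 0‖ ≤
        ‖shellAmplitude j f E T - shellAmplitude j f E 0‖ + ‖shellAmplitude j f E T‖ := by
      have := norm_sub_norm_le (shellAmplitude j f E 0) (shellAmplitude j f E T)
      rw [norm_sub_rev] at this
      linarith
    linarith [hstep T hT]
  have hZ0 : 0 ≤ Z := tsum_nonneg fun k => by positivity
  exact le_of_sq_le_mul (by positivity) hlim

/-! ### Closing the inequality and the decay of the potential. -/

theorem eq_zero_of_shell_decay_of_im_nonneg {d : ℕ} (hd : 3 ≤ d) {q ε : ℝ} (hq0 : 0 ≤ q)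
    (hq : q < 1 / 4) (hε0 : 0 ≤ ε) (hε : ε * (2 * (3 * 600 ^ d)) * (1 - 4 * q)⁻¹ < 1) {E : ℂ}
    (hE : 0 ≤ E.im) (f : LatticeL2 d)
    (hf : ∀ n, ‖(freeHamiltonian d f - E • f) n‖ ≤ ε * q ^ shellIndex n * ‖f n‖) : f = 0 := by
  set g := freeHamiltonian d f - E • f with hg
  have hz : ∀ k, ‖shellPart k g‖ ≤ ε * q ^ k * ‖shellPart k f‖ := fun k =>
    norm_shellPart_le_mul (by positivity) fun n hn => by rw [← hn]; exact hf n
  -- Finiteness of `Z` must be known before `Z` is absorbed; the crude bound `‖P_k f‖ ≤ ‖f‖` and `2q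
  -- < 1` provide it.
  have hs : Summable fun k => 2 ^ k * ‖shellPart k g‖ := by
    refine Summable.of_nonneg_of_le (fun k => by positivity) (fun k => ?_)
      ((summable_geometric_of_lt_one (r := 2 * q) (by positivity) (by linarith)).mul_left
        (ε * ‖f‖))
    calc (2 : ℝ) ^ k * ‖shellPart k g‖ ≤ 2 ^ k * (ε * q ^ k * ‖f‖) := by
          gcongr
          exact (hz k).trans (by gcongr; exact norm_shellPart_le k f)
      _ = _ := by rw [mul_pow]; ring
  have hx := fun k => norm_shellPart_le_tsum hd k f hE hs
  set Z := ∑' k, 2 ^ k * ‖shellPart k g‖ with hZ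
  have hZ0 : 0 ≤ Z := tsum_nonneg fun k => by positivity
  have hgeo := hasSum_geometric_of_lt_one (r := 4 * q) (by positivity) (by linarith)
  have hle : Z ≤ ε * (2 * (3 * 600 ^ d)) * Z * (1 - 4 * q)⁻¹ := by
    refine hasSum_le (fun k => ?_) hs.hasSum (hgeo.mul_left _)
    calc (2 : ℝ) ^ k * ‖shellPart k g‖
        ≤ 2 ^ k * (ε * q ^ k * (2 * (3 * 600 ^ d) * 2 ^ k * Z)) := by
          gcongr
          exact (hz k).trans (by gcongr; exact hx k)
      _ = _ := by
          rw [mul_pow, show (4 : ℝ) = 2 * 2 by norm_num, mul_pow]; ring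
  have hZz : Z = 0 := by
    by_contra h
    have hpos : 0 < Z := lt_of_le_of_ne hZ0 (Ne.symm h)
    nlinarith [mul_lt_mul_of_pos_right hε hpos]
  have hzero : ∀ k, shellPart k f = 0 := fun k => by
    have := hx k
    rw [hZz, mul_zero] at this
    exact norm_le_zero_iff.1 this
  have := hasSum_shellPart f
  simp only [hzero] at this
  exact this.unique hasSum_zero

theorem freeHamiltonian_star (d : ℕ) (f : LatticeL2 d) (n : Fin d → ℤ) :
    freeHamiltonian d (star f) n = star (freeHamiltonian d f n) := by
  rw [freeHamiltonian_apply, freeHamiltonian_apply]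
  simp

/-- `Ĥ₀` has real coefficients, so conjugating `f` replaces `E` by its conjugate and preserves the
pointwise bound. -/
theorem eq_zero_of_shell_decay {d : ℕ} (hd : 3 ≤ d) {q ε : ℝ} (hq0 : 0 ≤ q)
    (hq : q < 1 / 4) (hε0 : 0 ≤ ε) (hε : ε * (2 * (3 * 600 ^ d)) * (1 - 4 * q)⁻¹ < 1) {E : ℂ}
    (f : LatticeL2 d)
    (hf : ∀ n, ‖(freeHamiltonian d f - E • f) n‖ ≤ ε * q ^ shellIndex n * ‖f n‖) : f = 0 := by
  rcases le_total 0 E.im with hE | hE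
  · exact eq_zero_of_shell_decay_of_im_nonneg hd hq0 hq hε0 hε hE f hf
  · rw [← star_eq_zero]
    refine eq_zero_of_shell_decay_of_im_nonneg hd hq0 hq hε0 hε (E := star E)
      (by simpa using hE) (star f) fun n => ?_
    have h : (freeHamiltonian d (star f) - star E • star f) n =
        star ((freeHamiltonian d f - E • f) n) := by
      simp only [lp.coeFn_sub, lp.coeFn_smul, Pi.sub_apply, Pi.smul_apply, smul_eq_mul, star_sub,
        star_mul', freeHamiltonian_star, lp.star_apply]
    rw [h, norm_star, lp.star_apply, norm_star]
    exact hf n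

theorem exists_norm_le_mul_pow_shellIndex {d : ℕ} {V : (Fin d → ℤ) → ℂ} {s : ℝ} (hs : 0 ≤ s)
    (hV : V =O[comap latticeNorm atTop] fun n : Fin d → ℤ => latticeNorm n ^ (-s)) :
    ∃ K : ℝ, 0 < K ∧ ∀ n, ‖V n‖ ≤ K * ((2 : ℝ) ^ (-s)) ^ shellIndex n := by
  obtain ⟨c, hc⟩ := hV.bound
  obtain ⟨t, ht, hsub⟩ := mem_comap.1 hc
  obtain ⟨R, hR⟩ := mem_atTop_sets.1 ht
  have hq : (0 : ℝ) < 2 ^ (-s) := by positivity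
  obtain ⟨M, hM⟩ := ((finite_latticeNorm_le (d := d) (max R 1)).image
    fun n => ‖V n‖ / ((2 : ℝ) ^ (-s)) ^ shellIndex n).bddAbove
  -- `M` covers the finitely many points outside the asymptotic regime, `|c| 2^s` the rest, and `1`
  -- makes the constant positive.
  refine ⟨max 1 (max M (|c| * 2 ^ s)), by positivity, fun n => ?_⟩
  have hqn : 0 < ((2 : ℝ) ^ (-s)) ^ shellIndex n := by positivity
  by_cases h : latticeNorm n ≤ max R 1
  · rw [← div_le_iff₀ hqn]
    exact (hM ⟨n, h, rfl⟩).trans ((le_max_left _ _).trans (le_max_right _ _))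
  · rw [not_le, max_lt_iff] at h
    have h1 : ‖V n‖ ≤ c * ‖latticeNorm n ^ (-s)‖ := hsub (hR _ h.1.le)
    have hpos : 0 < latticeNorm n := by linarith
    rw [Real.norm_of_nonneg (Real.rpow_nonneg hpos.le _)] at h1
    have h2 := two_pow_shellIndex_le n h.2.le
    have h3 : latticeNorm n ^ (-s) ≤ 2 ^ s * ((2 : ℝ) ^ (-s)) ^ shellIndex n := by
      calc latticeNorm n ^ (-s) ≤ (2 ^ shellIndex n / 2) ^ (-s) :=
            Real.rpow_le_rpow_of_nonpos (by positivity) (by linarith) (by linarith)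
        _ = _ := by
            rw [Real.div_rpow (by positivity) (by norm_num), ← Real.rpow_natCast,
              ← Real.rpow_natCast, ← Real.rpow_mul (by norm_num), ← Real.rpow_mul (by norm_num),
              Real.rpow_neg (by norm_num) s, div_inv_eq_mul, mul_comm (-s), mul_comm]
    calc ‖V n‖ ≤ |c| * latticeNorm n ^ (-s) :=
          h1.trans (mul_le_mul_of_nonneg_right (le_abs_self c) (by positivity))
      _ ≤ |c| * (2 ^ s * ((2 : ℝ) ^ (-s)) ^ shellIndex n) := by gcongr
      _ = |c| * 2 ^ s * ((2 : ℝ) ^ (-s)) ^ shellIndex n := by ring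
      _ ≤ _ := by
          gcongr
          exact (le_max_right _ _).trans (le_max_right _ _)

theorem theorem5p7 (d : ℕ) (hd : 3 ≤ d) (V : (Fin d → ℤ) → ℂ) (s : ℝ) (hs : 2 < s)
    (hV : V =O[comap latticeNorm atTop] fun n : Fin d → ℤ => latticeNorm n ^ (-s)) :
    ∃ δ : ℝ, 0 < δ ∧ ∀ γ : ℂ, ‖γ‖ < δ → ∀ E : ℂ,
      ¬ Module.End.HasEigenvalue
        ((freeHamiltonian d +
            γ • potentialOperator V (memlp_top_of_decay (by linarith) hV) :
          LatticeL2 d →L[ℂ] LatticeL2 d) : LatticeL2 d →ₗ[ℂ] LatticeL2 d) E := by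
  obtain ⟨K, hK, hVK⟩ := exists_norm_le_mul_pow_shellIndex (by linarith) hV
  set q : ℝ := 2 ^ (-s) with hq
  have hq0 : 0 < q := by positivity
  have hq4 : q < 1 / 4 := by
    calc q < (2 : ℝ) ^ (-2 : ℝ) := Real.rpow_lt_rpow_of_exponent_lt (by norm_num) (by linarith)
      _ = 1 / 4 := by rw [Real.rpow_neg (by norm_num)]; norm_num
  have hA : 0 < K * (2 * (3 * 600 ^ d)) * (1 - 4 * q)⁻¹ := by
    have : 0 < 1 - 4 * q := by linarith
    positivity
  -- This `δ` is the threshold at which `ε = ‖γ‖ K` meets the smallness condition.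
  refine ⟨(K * (2 * (3 * 600 ^ d)) * (1 - 4 * q)⁻¹)⁻¹, inv_pos.2 hA, fun γ hγ E hE => ?_⟩
  obtain ⟨f, hf⟩ := hE.exists_hasEigenvector
  refine hf.2 (eq_zero_of_shell_decay hd hq0.le hq4 (ε := ‖γ‖ * K) (by positivity) ?_ (E := E) f
    fun n => ?_)
  · rw [← one_div, lt_div_iff₀ hA] at hγ
    linarith
  · have h1 : freeHamiltonian d f + γ • potentialOperator V
        (memlp_top_of_decay (by linarith) hV) f = E • f := hf.apply_eq_smul
    have h2 : freeHamiltonian d f - E • f =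
        -(γ • potentialOperator V (memlp_top_of_decay (by linarith) hV) f) := by
      rw [← h1]; abel
    rw [h2, lp.coeFn_neg, Pi.neg_apply, norm_neg, lp.coeFn_smul, Pi.smul_apply,
      potentialOperator_apply, smul_eq_mul, norm_mul, norm_mul]
    calc ‖γ‖ * (‖V n‖ * ‖f n‖) ≤ ‖γ‖ * (K * q ^ shellIndex n * ‖f n‖) := by
          gcongr
          exact hVK n
      _ = _ := by ring
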